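/- **Theorem 2.** Let $\alpha>-1$, $\nu\ge 0$, and let $\rho_\nu(x)=2x^{\nu/2}K_\nu(2\sqrt x)$ for $x>0$, where $K_\nu(z)=\int_0^\infty e^{-z\cosh u}\cosh(\nu u)\,du$ is the modified Bessel function of the second kind; for $\nu>0$ put $\rho_\nu(0)=\lim_{x\to0+}\rho_\nu(x)=\Gamma(\nu)$. For $\lambda,t\ge 0$ with $\lambda^2+t^2\ne 0$ (and $t>0$ if $\nu=0$), let $P_n(x)=P_n(x;\lambda,t)=a_nx^n+\dots$, $a_n=a_n(\lambda,t)>0$, $n=0,1,2,\dots$, be the orthonormal polynomials for the weight $x^\alpha e^{-\lambda x}\rho_\nu(xt)$ on $(0,\infty)$, that is, $\deg P_n=n$ and $$\int_0^\infty P_m(x;\lambda,t)\,P_n(x;\lambda,t)\,x^\alpha e^{-\lambda x}\rho_\nu(xt)\,dx=\delta_{mn},\qquad m,n\ge 0,$$ and let $A_n=a_{n-1}/a_n$ for $n\ge1$. Then for every $n\ge 1$ and all such $\lambda,t$, the functions $a_n$ and $P_n(x;\cdot,\cdot)$, for each fixed real $x$, are differentiable in $\lambda$ (from the right if $\lambda=0$)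 and, if $t>0$, in $t$, and for all real $x$ $$\frac{\partial P_n}{\partial\lambda}-\frac1{a_n}\frac{\partial a_n}{\partial\lambda}\,P_n-A_nP_{n-1}=0,$$ $$\Bigl(t\frac{\partial}{\partial t}-x\frac{\partial}{\partial x}\Bigr)P_n-\Bigl[\frac{t}{a_n}\frac{\partial a_n}{\partial t}-n\Bigr]P_n+\lambda A_nP_{n-1}=0,$$ where for $t=0$ the terms containing $t\,\partial/\partial t$ are read as $0$. -/

import Mathlib

open MeasureTheory Set Polynomial

/-- The modified Bessel function of the second kind (Macdonald function)
`K_ν(z) = ∫_0^∞ e^{-z cosh u} cosh(ν u) du`, for real order `ν` and real argument `z > 0`. -/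
noncomputable def besselK (ν z : ℝ) : ℝ :=
  ∫ u in Ioi (0 : ℝ), Real.exp (-z * Real.cosh u) * Real.cosh (ν * u)

/-- The scaled Macdonald function `ρ_ν(x) = 2 x^{ν/2} K_ν(2 √x)` for `x > 0`, extended to `x = 0`
by its limit `ρ_ν(0) = Γ(ν)`, which is finite for `ν > 0`. -/
noncomputable def rho (ν x : ℝ) : ℝ :=
  if x = 0 then Real.Gamma ν else 2 * x ^ (ν / 2) * besselK ν (2 * Real.sqrt x)

/-- The weight `x^α e^{-λ x} ρ_ν(x t)` on `x > 0` (the parameter `λ` is written `l`). -/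
noncomputable def weight (α ν l t x : ℝ) : ℝ :=
  x ^ α * Real.exp (-l * x) * rho ν (x * t)

/-- The admissible parameters: `λ, t ≥ 0` with `λ² + t² ≠ 0`; if `t = 0`, then the weight contains
the factor `ρ_ν(0)`, so that `ν > 0` is needed in this case. -/
def Admissible (ν l t : ℝ) : Prop :=
  0 ≤ l ∧ 0 ≤ t ∧ l ^ 2 + t ^ 2 ≠ 0 ∧ (t = 0 → 0 < ν)

/-- `p` is the sequence of orthonormal polynomials for the weight `x^α e^{-λ x} ρ_ν(x t)` on
`(0, ∞)`: `p n` has degree `n` and positive leading coefficient, and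
`∫_0^∞ p_m p_n x^α e^{-λ x} ρ_ν(x t) dx = δ_{mn}`, all these integrals being convergent. -/
structure IsOrthonormalSeq (α ν l t : ℝ) (p : ℕ → ℝ[X]) : Prop where
  natDegree_eq : ∀ n, (p n).natDegree = n
  leadingCoeff_pos : ∀ n, 0 < (p n).leadingCoeff
  integrable : ∀ m n, IntegrableOn
    (fun x : ℝ => (p m).eval x * (p n).eval x * weight α ν l t x) (Ioi 0)
  integral_eq : ∀ m n,
    ∫ x in Ioi (0 : ℝ), (p m).eval x * (p n).eval x * weight α ν l t x = if m = n then 1 else 0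

/-! The polynomials depend on the weight only through its moments `m_k`, and `∂m_k/∂λ = -m_{k+1}`.
By Cramer's rule for the Hankel system, `a_n²` and `a_n P_n` have coefficients rational in the
moments, so everything is differentiable in `λ`. Differentiating `L(P_n x^j) = 0` for `j < n` gives
`L(∂P_n/∂λ · x^j) = L(P_n x^{j+1})`, which is zero unless `j = n - 1`. Removing the multiple of
`P_n` that cancels the top coefficient therefore leaves exactly `A_n P_{n-1}`
(`sum_derivWithin_coeff_mul_X_pow`).

The equation in `t` needs no differentiation of `ρ_ν`. The substitution `x ↦ cx` gives `P_n(x; cλ,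
ct) = c^{(α+1)/2} P_n(cx; λ, t)` (`rescale`), so `λ∂_λ + t∂_t - x∂_x` multiplies `P_n` by `(α+1)/2`,
and `λ∂_λ + t∂_t` multiplies `a_n` by `(α+1)/2 + n`. Eliminating `∂_λ` with the first equation gives
the second. -/

open Filter Topology

/-! ### Orthonormal polynomials for a moment functional -/

/-- The linear functional on polynomials with moments `m`. -/
noncomputable def momentFunctional (m : ℕ → ℝ) : ℝ[X] →ₗ[ℝ] ℝ :=
  Polynomial.lsum fun k => m k • LinearMap.id

theorem momentFunctional_eq_sum (m : ℕ → ℝ) {p : ℝ[X]} {N : ℕ} (hp : p.natDegree < N) :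
    momentFunctional m p = ∑ k ∈ Finset.range N, p.coeff k * m k := by
  rw [momentFunctional, Polynomial.lsum_apply, Polynomial.sum_over_range' _ _ N hp]
  · simp [mul_comm]
  · simp

/-- `p` is an orthonormal sequence, with positive leading coefficients, for the bilinear form
`(f, g) ↦ L (f * g)`. -/
structure IsOrthonormalFor (L : ℝ[X] →ₗ[ℝ] ℝ) (p : ℕ → ℝ[X]) : Prop where
  natDegree_eq : ∀ n, (p n).natDegree = n
  leadingCoeff_pos : ∀ n, 0 < (p n).leadingCoeff
  apply_mul : ∀ m n, L (p m * p n) = if m = n then 1 else 0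

namespace IsOrthonormalFor

variable {L : ℝ[X] →ₗ[ℝ] ℝ} {p : ℕ → ℝ[X]}

theorem coeff_pos (h : IsOrthonormalFor L p) (n : ℕ) : 0 < (p n).coeff n := by
  simpa [leadingCoeff, h.natDegree_eq] using h.leadingCoeff_pos n

theorem degree_sub_C_mul_lt (h : IsOrthonormalFor L p) {n : ℕ} {q : ℝ[X]}
    (hq : q.natDegree ≤ n) : (q - C (q.coeff n / (p n).coeff n) * p n).degree < (n : ℕ) := by
  rw [Polynomial.degree_lt_iff_coeff_zero]
  intro i hi
  rcases hi.eq_or_lt with rfl | hi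
  · simp [div_mul_cancel₀ _ (h.coeff_pos n).ne']
  · have h1 : q.coeff i = 0 := coeff_eq_zero_of_natDegree_lt (hq.trans_lt hi)
    have h2 : (p n).coeff i = 0 :=
      coeff_eq_zero_of_natDegree_lt (by rw [h.natDegree_eq]; exact hi)
    simp [h1, h2]

/-- Modulo polynomials of degree below `n`, which are orthogonal to `p n`, `q` is the multiple of `p
n` with the same top coefficient. -/
theorem apply_mul_of_natDegree_le (h : IsOrthonormalFor L p) {n : ℕ} {q : ℝ[X]}
    (hq : q.natDegree ≤ n) : L (p n * q) = q.coeff n / (p n).coeff n := by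
  have key : ∀ k ≤ n, ∀ q : ℝ[X], q.degree < (k : ℕ) → L (p n * q) = 0 := by
    intro k
    induction k with
    | zero =>
      intro _ q hq
      have : q = 0 := by simpa using hq
      simp [this]
    | succ k ih =>
      intro hk q hq
      have hdec : q = (q - C (q.coeff k / (p k).coeff k) * p k)
          + C (q.coeff k / (p k).coeff k) * p k := by ring
      have hlt := h.degree_sub_C_mul_lt (q := q) (n := k)
        (natDegree_le_iff_coeff_eq_zero.2 fun i hi =>
          coeff_eq_zero_of_degree_lt (hq.trans_le (by exact_mod_cast hi)))
      rw [hdec, mul_add, map_add, ih (by omega) _ hlt, mul_left_comm, ← smul_eq_C_mul, map_smul,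
        h.apply_mul, if_neg (by omega)]
      simp
  have hdec : q = (q - C (q.coeff n / (p n).coeff n) * p n)
      + C (q.coeff n / (p n).coeff n) * p n := by ring
  have hlt := h.degree_sub_C_mul_lt hq
  conv_lhs => rw [hdec]
  rw [mul_add, map_add, key n le_rfl _ hlt, mul_left_comm, ← smul_eq_C_mul, map_smul,
    h.apply_mul, if_pos rfl]
  simp

theorem apply_mul_X_pow (h : IsOrthonormalFor L p) {n j : ℕ} (hj : j ≤ n) :
    L (p n * X ^ j) = if j = n then 1 / (p n).coeff n else 0 := by
  rw [h.apply_mul_of_natDegree_le (by simpa using hj), coeff_X_pow]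
  by_cases hjn : j = n
  · simp [hjn]
  · simp [hjn, Ne.symm hjn]

/-- Otherwise pair `q` with the orthonormal polynomial of the same degree: the result is a ratio of
nonzero leading coefficients. -/
theorem eq_zero_of_apply_mul_X_pow (h : IsOrthonormalFor L p) {n : ℕ} {q : ℝ[X]}
    (hq : q.natDegree ≤ n) (hL : ∀ j ≤ n, L (q * X ^ j) = 0) : q = 0 := by
  by_contra hne
  have h1 : L (q * p q.natDegree) = 0 := by
    conv_lhs => rw [(p q.natDegree).as_sum_range_C_mul_X_pow]
    rw [Finset.mul_sum, map_sum]
    refine Finset.sum_eq_zero fun j hj => ?_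
    rw [h.natDegree_eq, Finset.mem_range] at hj
    rw [mul_left_comm, ← smul_eq_C_mul, map_smul, hL j (by omega), smul_zero]
  rw [mul_comm, h.apply_mul_of_natDegree_le le_rfl, div_eq_zero_iff] at h1
  rcases h1 with h1 | h1
  · exact hne (leadingCoeff_eq_zero.1 h1)
  · exact (h.coeff_pos _).ne' h1

/-- The polynomial `a_n p_n` pairs with `X ^ j`, `j ≤ n`, to `δ_{jn}`, so `L` alone determines it;
its top coefficient `a_n²` fixes `a_n > 0`. -/
theorem unique {q : ℕ → ℝ[X]} (hp : IsOrthonormalFor L p) (hq : IsOrthonormalFor L q) (n : ℕ) :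
    p n = q n := by
  have hpn := hp.coeff_pos n
  have hqn := hq.coeff_pos n
  have h0 : C ((p n).coeff n) * p n - C ((q n).coeff n) * q n = 0 := by
    refine hp.eq_zero_of_apply_mul_X_pow (n := n) ?_ fun j hj => ?_
    · refine (natDegree_sub_le _ _).trans (max_le ?_ ?_)
      · exact (natDegree_C_mul_le _ _).trans (hp.natDegree_eq n).le
      · exact (natDegree_C_mul_le _ _).trans (hq.natDegree_eq n).le
    · rw [sub_mul, map_sub, mul_assoc, mul_assoc, ← smul_eq_C_mul, ← smul_eq_C_mul, map_smul,
        map_smul, hp.apply_mul_X_pow hj, hq.apply_mul_X_pow hj]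
      split_ifs <;> simp [hpn.ne', hqn.ne']
  have hc : (p n).coeff n = (q n).coeff n := by
    have := congrArg (fun r : ℝ[X] => r.coeff n) h0
    simp only [coeff_sub, coeff_C_mul, coeff_zero] at this
    nlinarith
  rw [hc, ← mul_sub] at h0
  rcases mul_eq_zero.1 h0 with h1 | h1
  · exact absurd (C_eq_zero.1 h1) hqn.ne'
  · exact sub_eq_zero.1 h1

end IsOrthonormalFor

/-! ### Hankel systems and Cramer's rule -/

/-- The Hankel matrix of order `n + 1` of the moments `m`. -/
def hankel (m : ℕ → ℝ) (n : ℕ) : Matrix (Fin (n + 1)) (Fin (n + 1)) ℝ :=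
  Matrix.of fun i j => m (i + j)

theorem momentFunctional_mul_X_pow (m : ℕ → ℝ) {p : ℝ[X]} {N : ℕ} (hp : p.natDegree < N) (j : ℕ) :
    momentFunctional m (p * X ^ j) = ∑ k ∈ Finset.range N, p.coeff k * m (k + j) := by
  have hdeg : (p * X ^ j).natDegree < j + N := by
    refine natDegree_mul_le.trans_lt ?_
    rw [natDegree_X_pow]; omega
  rw [momentFunctional_eq_sum m hdeg, Finset.sum_range_add]
  have h0 : ∑ x ∈ Finset.range j, (p * X ^ j).coeff x * m x = 0 :=
    Finset.sum_eq_zero fun k hk => by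
      rw [coeff_mul_X_pow', if_neg (by simpa using hk), zero_mul]
  rw [h0, zero_add]
  refine Finset.sum_congr rfl fun k _ => ?_
  rw [add_comm j k, coeff_mul_X_pow]

theorem hankel_mulVec_coeff (m : ℕ → ℝ) {n : ℕ} {p : ℝ[X]} (hp : p.natDegree ≤ n)
    (i : Fin (n + 1)) :
    (hankel m n).mulVec (fun j => p.coeff j) i = momentFunctional m (p * X ^ (i : ℕ)) := by
  rw [momentFunctional_mul_X_pow m (Nat.lt_succ_of_le hp), Finset.sum_range]
  simp only [Matrix.mulVec, dotProduct, hankel, Matrix.of_apply]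
  exact Finset.sum_congr rfl fun j _ => by
    rw [mul_comm, Nat.add_comm (i : ℕ)]

theorem IsOrthonormalFor.det_hankel_ne_zero {m : ℕ → ℝ} {p : ℕ → ℝ[X]}
    (h : IsOrthonormalFor (momentFunctional m) p) (n : ℕ) : (hankel m n).det ≠ 0 := by
  intro hdet
  obtain ⟨v, hv, hv0⟩ := Matrix.exists_mulVec_eq_zero_iff.2 hdet
  set q : ℝ[X] := ∑ i : Fin (n + 1), C (v i) * X ^ (i : ℕ) with hq
  have hqc : ∀ j : Fin (n + 1), q.coeff j = v j := by
    intro j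
    simp [hq, finsetSum_coeff, coeff_X_pow, Fin.val_inj]
  have hqd : q.natDegree ≤ n := by
    refine natDegree_sum_le_of_forall_le _ _ fun i _ => ?_
    exact (natDegree_C_mul_X_pow_le _ _).trans (by omega)
  have hq0 : q = 0 := by
    refine h.eq_zero_of_apply_mul_X_pow hqd fun j hj => ?_
    have := hankel_mulVec_coeff m hqd ⟨j, Nat.lt_succ_of_le hj⟩
    simp only [hqc, hv0] at this
    simpa using this.symm
  apply hv
  ext j
  rw [← hqc j, hq0]; simp

/-- The coefficient vector solves a Hankel system with right side `e_n / a_n`; the factor `(p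
n).coeff n` makes the right side independent of `p`. -/
theorem IsOrthonormalFor.coeff_mul_coeff {m : ℕ → ℝ} {p : ℕ → ℝ[X]}
    (h : IsOrthonormalFor (momentFunctional m) p) (n : ℕ) (i : Fin (n + 1)) :
    (p n).coeff i * (p n).coeff n
      = (hankel m n).adjugate i (Fin.last n) / (hankel m n).det := by
  have hdet := h.det_hankel_ne_zero n
  have hmv : (hankel m n).mulVec (fun j => (p n).coeff j)
      = Pi.single (Fin.last n) (1 / (p n).coeff n) := by
    ext j
    rw [hankel_mulVec_coeff m (h.natDegree_eq n).le, h.apply_mul_X_pow (Nat.le_of_lt_succ j.2)]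
    by_cases hj : j = Fin.last n
    · simp [hj]
    · have : (j : ℕ) ≠ n := fun hjn => hj (Fin.ext hjn)
      simp [hj, this]
  have := congrArg (fun v => (hankel m n).adjugate.mulVec v i) hmv
  simp only [Matrix.mulVec_mulVec, Matrix.adjugate_mul, Matrix.smul_mulVec, Matrix.one_mulVec,
    Matrix.mulVec_single, Pi.smul_apply, smul_eq_mul, Matrix.col_apply, MulOpposite.smul_eq_mul_unop,
    MulOpposite.unop_op] at this
  have hpn := (h.coeff_pos n).ne'
  field_simp at this ⊢
  linarith

theorem DifferentiableWithinAt.matrix_det_apply {ι : Type*} [Fintype ι] [DecidableEq ι]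
    {M : ℝ → Matrix ι ι ℝ} {S : Set ℝ} {s : ℝ}
    (hM : ∀ i j, DifferentiableWithinAt ℝ (fun u => M u i j) S s) :
    DifferentiableWithinAt ℝ (fun u => (M u).det) S s := by
  simp only [Matrix.det_apply']
  refine DifferentiableWithinAt.fun_sum fun σ _ => ?_
  refine DifferentiableWithinAt.const_mul ?_ _
  exact DifferentiableWithinAt.fun_finsetProd fun i _ => hM _ _

theorem DifferentiableWithinAt.matrix_adjugate_apply {ι : Type*} [Fintype ι] [DecidableEq ι]
    {M : ℝ → Matrix ι ι ℝ} {S : Set ℝ} {s : ℝ}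
    (hM : ∀ i j, DifferentiableWithinAt ℝ (fun u => M u i j) S s) (i j : ι) :
    DifferentiableWithinAt ℝ (fun u => (M u).adjugate i j) S s := by
  simp only [Matrix.adjugate_apply]
  refine DifferentiableWithinAt.matrix_det_apply fun a b => ?_
  by_cases ha : a = j
  · simpa [ha, Matrix.updateRow_self] using differentiableWithinAt_const _
  · simpa [Matrix.updateRow_ne ha] using hM a b

/-! ### Families whose moments depend on a parameter -/

section Family

variable {m : ℝ → ℕ → ℝ} {p : ℝ → ℕ → ℝ[X]} {S : Set ℝ} {s : ℝ}

theorem differentiableWithinAt_coeff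
    (hp : ∀ᶠ u in 𝓝[S] s, IsOrthonormalFor (momentFunctional (m u)) (p u)) (hs : s ∈ S)
    (hm : ∀ k, DifferentiableWithinAt ℝ (fun u => m u k) S s) (n k : ℕ) :
    DifferentiableWithinAt ℝ (fun u => (p u n).coeff k) S s := by
  have hps := hp.self_of_nhdsWithin hs
  rcases lt_or_ge n k with hk | hk
  · refine (differentiableWithinAt_const (0 : ℝ)).congr_of_eventuallyEq_of_mem ?_ hs
    filter_upwards [hp] with u hu
    exact coeff_eq_zero_of_natDegree_lt (by rwa [hu.natDegree_eq])
  have hH : ∀ i j, DifferentiableWithinAt ℝ (fun u => hankel (m u) n i j) S s :=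
    fun i j => hm _
  have hF : ∀ i : Fin (n + 1), DifferentiableWithinAt ℝ
      (fun u => (p u n).coeff i * (p u n).coeff n) S s := by
    intro i
    refine DifferentiableWithinAt.congr_of_eventuallyEq_of_mem
      (f := fun u => (hankel (m u) n).adjugate i (Fin.last n) / (hankel (m u) n).det) ?_ ?_ hs
    · exact (DifferentiableWithinAt.matrix_adjugate_apply hH _ _).div
        (DifferentiableWithinAt.matrix_det_apply hH) (hps.det_hankel_ne_zero n)
    · filter_upwards [hp] with u hu
      exact hu.coeff_mul_coeff n i
  have hn := hF (Fin.last n)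
  simp only [Fin.val_last] at hn
  have hpos := hps.coeff_pos n
  -- The case `k = n` gives `a_n²`; positivity allows the square root and then division by `a_n`.
  have ha : DifferentiableWithinAt ℝ (fun u => (p u n).coeff n) S s := by
    refine (hn.sqrt (mul_pos hpos hpos).ne').congr_of_eventuallyEq_of_mem ?_ hs
    filter_upwards [hp] with u hu
    exact (Real.sqrt_mul_self (hu.coeff_pos n).le).symm
  refine ((hF ⟨k, Nat.lt_succ_of_le hk⟩).div ha hpos.ne').congr_of_eventuallyEq_of_mem ?_ hs
  filter_upwards [hp] with u hu
  have := (hu.coeff_pos n).ne'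
  simp [this]

/-- If `dm_k/du = -m_{k+1}`, the derivative of the `n`-th orthonormal polynomial is a combination
of the `n`-th and `(n-1)`-st. -/
theorem sum_derivWithin_coeff_mul_X_pow
    (hp : ∀ᶠ u in 𝓝[S] s, IsOrthonormalFor (momentFunctional (m u)) (p u)) (hs : s ∈ S)
    (hS : UniqueDiffWithinAt ℝ S s)
    (hm : ∀ k, HasDerivWithinAt (fun u => m u k) (-m s (k + 1)) S s) (n : ℕ) (hn : 1 ≤ n) :
    ∑ k ∈ Finset.range (n + 1), C (derivWithin (fun u => (p u n).coeff k) S s) * X ^ k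
      = C (derivWithin (fun u => (p u n).coeff n) S s / (p s n).coeff n) * p s n
        + C ((p s (n - 1)).coeff (n - 1) / (p s n).coeff n) * p s (n - 1) := by
  have hps := hp.self_of_nhdsWithin hs
  have hd : ∀ k, HasDerivWithinAt (fun u => (p u n).coeff k)
      (derivWithin (fun u => (p u n).coeff k) S s) S s := fun k =>
    (differentiableWithinAt_coeff hp hs (fun k => (hm k).differentiableWithinAt) n k).hasDerivWithinAt
  set d : ℕ → ℝ := fun k => derivWithin (fun u => (p u n).coeff k) S s with hd_def
  set D : ℝ[X] := ∑ k ∈ Finset.range (n + 1), C (d k) * X ^ k with hD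
  have hDc : ∀ k ≤ n, D.coeff k = d k := by
    intro k hk
    simp only [hD, finsetSum_coeff, coeff_C_mul_X_pow]
    rw [Finset.sum_ite_eq, if_pos (by simpa using Nat.lt_succ_of_le hk)]
  have hDd : D.natDegree ≤ n := by
    refine natDegree_sum_le_of_forall_le _ _ fun i hi => ?_
    exact (natDegree_C_mul_X_pow_le _ _).trans (by simpa using hi)
  -- Product rule applied to `L_u(p_n X^j) = 0`: the derivative of the moments shifts `j` to `j + 1`
  -- with a minus sign.
  have hDL : ∀ j < n, momentFunctional (m s) (D * X ^ j)
      = momentFunctional (m s) (p s n * X ^ (j + 1)) := by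
    intro j hj
    have h1 : HasDerivWithinAt (fun u => ∑ k ∈ Finset.range (n + 1), (p u n).coeff k * m u (k + j))
        (∑ k ∈ Finset.range (n + 1),
          (d k * m s (k + j) + (p s n).coeff k * (-m s (k + j + 1)))) S s :=
      HasDerivWithinAt.fun_sum fun k _ => (hd k).mul (hm (k + j))
    have h2 : HasDerivWithinAt (fun u => ∑ k ∈ Finset.range (n + 1), (p u n).coeff k * m u (k + j))
        0 S s := by
      refine (hasDerivWithinAt_const s S (0 : ℝ)).congr_of_eventuallyEq_of_mem ?_ hs
      filter_upwards [hp] with u hu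
      rw [← momentFunctional_mul_X_pow _ (Nat.lt_succ_of_le (hu.natDegree_eq n).le),
        hu.apply_mul_X_pow hj.le, if_neg hj.ne]
    have h3 := hS.eq_deriv _ h1 h2
    rw [momentFunctional_mul_X_pow _ (Nat.lt_succ_of_le hDd),
      momentFunctional_mul_X_pow _ (Nat.lt_succ_of_le (hps.natDegree_eq n).le), ← sub_eq_zero, ← h3,
      ← Finset.sum_sub_distrib]
    refine Finset.sum_congr rfl fun k hk => ?_
    rw [hDc k (by simpa [Nat.lt_succ_iff] using hk), ← add_assoc]; ring
  have han := (hps.coeff_pos n).ne'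
  have han' := (hps.coeff_pos (n - 1)).ne'
  rw [← sub_eq_zero]
  -- The coefficients of `X ^ n` cancel, so testing against `X ^ j` with `j ≤ n - 1` suffices; both
  -- sides are nonzero only at `j = n - 1`.
  refine hps.eq_zero_of_apply_mul_X_pow (n := n - 1) ?_ fun j hj => ?_
  · rw [natDegree_le_iff_coeff_eq_zero]
    intro i hi
    have hz : (p s (n - 1)).coeff i = 0 :=
      coeff_eq_zero_of_natDegree_lt (by rwa [hps.natDegree_eq])
    rcases (show n ≤ i by omega).eq_or_lt with rfl | hi'
    · simp [hDc, hz, han, hd_def]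
    · have h1 : D.coeff i = 0 := coeff_eq_zero_of_natDegree_lt (by omega)
      have h2 : (p s n).coeff i = 0 :=
        coeff_eq_zero_of_natDegree_lt (by rwa [hps.natDegree_eq])
      simp [h1, h2, hz]
  · rw [sub_mul, add_mul, map_sub, map_add, mul_assoc, mul_assoc, ← smul_eq_C_mul, ← smul_eq_C_mul,
      map_smul, map_smul, hDL j (by omega), hps.apply_mul_X_pow (show j ≤ n by omega),
      hps.apply_mul_X_pow hj, hps.apply_mul_X_pow (show j + 1 ≤ n by omega),
      if_neg (show j ≠ n by omega)]
    by_cases hjn : j = n - 1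
    · rw [if_pos (by omega), if_pos hjn]
      simp only [smul_eq_mul]
      field_simp
      ring
    · rw [if_neg (by omega), if_neg hjn]
      simp

end Family

/-! ### Integration against a weight -/

section Weight

variable {w : ℝ → ℝ}

/-- As `p 0` is a nonzero constant, each `p n * w` is integrable, and the `p n` span all
polynomials. -/
theorem integrableOn_eval_mul {p : ℕ → ℝ[X]} (hdeg : ∀ n, (p n).natDegree = n)
    (hlead : ∀ n, 0 < (p n).leadingCoeff)
    (hint : ∀ m n, IntegrableOn (fun x : ℝ => (p m).eval x * (p n).eval x * w x) (Ioi 0))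
    (q : ℝ[X]) : IntegrableOn (fun x : ℝ => q.eval x * w x) (Ioi 0) := by
  let S : Polynomial.Sequence ℝ := ⟨p, fun n => by
    rw [degree_eq_natDegree (leadingCoeff_ne_zero.1 (hlead n).ne'), hdeg]⟩
  have hq : q ∈ Submodule.span ℝ (Set.range S) := by
    rw [S.span fun i => (hlead i).ne'.isUnit]; trivial
  induction hq using Submodule.span_induction with
  | mem q hq =>
    obtain ⟨n, rfl⟩ := hq
    obtain ⟨c, hc⟩ := natDegree_eq_zero.1 (hdeg 0)
    have hc0 : c ≠ 0 := by
      have := (hlead 0).ne'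
      rwa [← hc, leadingCoeff_C] at this
    have := (hint 0 n).const_mul c⁻¹
    refine this.congr (ae_of_all _ fun x => ?_)
    change c⁻¹ * ((p 0).eval x * (p n).eval x * w x) = (p n).eval x * w x
    rw [← hc, eval_C]
    field_simp
  | zero => simp
  | add f g _ _ hf hg => exact (hf.add hg).congr (ae_of_all _ fun x => by simp [add_mul])
  | smul c f _ hf => exact (hf.const_mul c).congr (ae_of_all _ fun x => by simp [mul_assoc])

theorem integral_eval_mul (hint : ∀ k : ℕ, IntegrableOn (fun x : ℝ => x ^ k * w x) (Ioi 0))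
    (q : ℝ[X]) : ∫ x in Ioi (0 : ℝ), q.eval x * w x
      = momentFunctional (fun k => ∫ x in Ioi (0 : ℝ), x ^ k * w x) q := by
  rw [momentFunctional_eq_sum _ (Nat.lt_succ_self _)]
  simp_rw [eval_eq_sum_range, Finset.sum_mul, ← integral_const_mul]
  rw [integral_finsetSum]
  · simp_rw [mul_assoc]
  · intro k _
    simpa [mul_assoc] using (hint k).const_mul (q.coeff k)

end Weight

/-- Follows from `1 + y ≤ exp y`; it dominates the difference quotients of the Laplace transform
uniformly in the parameter. -/
theorem Real.abs_exp_sub_exp_le {a b c : ℝ} (ha : a ≤ c) (hb : b ≤ c) :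
    |Real.exp a - Real.exp b| ≤ Real.exp c * |a - b| := by
  wlog hab : b ≤ a generalizing a b
  · rw [abs_sub_comm, abs_sub_comm a]
    exact this hb ha (le_of_not_ge hab)
  rw [abs_of_nonneg (sub_nonneg.2 (Real.exp_le_exp.2 hab)), abs_of_nonneg (sub_nonneg.2 hab)]
  have h1 : Real.exp b = Real.exp a * Real.exp (b - a) := by rw [← Real.exp_add]; ring_nf
  have h2 := Real.add_one_le_exp (b - a)
  have h3 : Real.exp a * (b - a + 1) ≤ Real.exp b := by
    rw [h1]; exact mul_le_mul_of_nonneg_left h2 (Real.exp_pos a).le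
  have h4 : Real.exp a * (a - b) ≤ Real.exp c * (a - b) :=
    mul_le_mul_of_nonneg_right (Real.exp_le_exp.2 ha) (sub_nonneg.2 hab)
  linarith

/-- Differentiation of a Laplace transform under the integral sign, from the right at the endpoint
of the interval of convergence. -/
theorem hasDerivWithinAt_integral_exp_mul {v : ℝ → ℝ} {s₀ s : ℝ} (hs : s₀ ≤ s)
    (hv : ∀ u, s₀ ≤ u → IntegrableOn (fun x => Real.exp (-u * x) * v x) (Ioi 0))
    (hxv : IntegrableOn (fun x => x * (Real.exp (-s₀ * x) * v x)) (Ioi 0)) :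
    HasDerivWithinAt (fun u => ∫ x in Ioi (0 : ℝ), Real.exp (-u * x) * v x)
      (-∫ x in Ioi (0 : ℝ), x * (Real.exp (-s * x) * v x)) (Ici s₀) s := by
  rw [hasDerivWithinAt_iff_tendsto_slope, ← integral_neg]
  have hmem : ∀ᶠ u in 𝓝[Ici s₀ \ {s}] s, u ∈ Ici s₀ \ {s} := self_mem_nhdsWithin
  have hpt : ∀ x : ℝ, HasDerivAt (fun u => Real.exp (-u * x) * v x)
      (-(x * (Real.exp (-s * x) * v x))) s := by
    intro x
    have h1 : HasDerivAt (fun u : ℝ => -u * x) (-1 * x) s := (hasDerivAt_id s).neg.mul_const x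
    exact (h1.exp.mul_const (v x)).congr_deriv (by ring)
  have key : Tendsto (fun u => ∫ x in Ioi (0 : ℝ), slope (fun u => Real.exp (-u * x) * v x) s u)
      (𝓝[Ici s₀ \ {s}] s) (𝓝 (∫ x in Ioi (0 : ℝ), -(x * (Real.exp (-s * x) * v x)))) := by
    refine tendsto_integral_filter_of_dominated_convergence
      (fun x => ‖x * (Real.exp (-s₀ * x) * v x)‖) ?_ ?_ hxv.norm ?_
    · filter_upwards [hmem] with u hu
      simp only [slope_def_field]
      exact (((hv u hu.1).sub (hv s hs)).div_const _).aestronglyMeasurable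
    · filter_upwards [hmem] with u hu
      refine (ae_restrict_iff' measurableSet_Ioi).2 (ae_of_all _ fun x hx => ?_)
      have hx0 : (0 : ℝ) < x := hx
      have hus : 0 < |u - s| := abs_pos.2 (sub_ne_zero.2 hu.2)
      have h1 := Real.abs_exp_sub_exp_le (a := -u * x) (b := -s * x) (c := -s₀ * x)
        (by have : s₀ ≤ u := hu.1
            nlinarith) (by nlinarith)
      have h2 : |(-u * x) - (-s * x)| = |u - s| * x := by
        rw [show (-u * x) - (-s * x) = -((u - s) * x) by ring, abs_neg, abs_mul, abs_of_pos hx0]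
      rw [h2] at h1
      rw [slope_def_field, ← sub_mul, norm_div, Real.norm_eq_abs, Real.norm_eq_abs,
        Real.norm_eq_abs, div_le_iff₀ hus, abs_mul, abs_mul, abs_mul, abs_of_pos hx0, Real.abs_exp]
      calc _ ≤ (Real.exp (-s₀ * x) * (|u - s| * x)) * |v x| :=
            mul_le_mul_of_nonneg_right h1 (abs_nonneg _)
        _ = _ := by ring
    · refine ae_of_all _ fun x => ?_
      exact (hasDerivWithinAt_iff_tendsto_slope.1 (hpt x).hasDerivWithinAt)
  refine key.congr' ?_
  filter_upwards [hmem] with u hu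
  simp only [slope_def_field]
  rw [integral_div, integral_sub (hv u hu.1) (hv s hs)]

/-! ### Moments and dilations of the Bessel weight -/

/-- The moments of the weight `x^α e^{-λ x} ρ_ν(x t)`. -/
noncomputable def weightMoment (α ν l t : ℝ) (k : ℕ) : ℝ :=
  ∫ x in Ioi (0 : ℝ), x ^ k * weight α ν l t x

namespace IsOrthonormalSeq

variable {α ν l t : ℝ} {p : ℕ → ℝ[X]}

theorem integrableOn_pow_mul (h : IsOrthonormalSeq α ν l t p) (k : ℕ) :
    IntegrableOn (fun x : ℝ => x ^ k * weight α ν l t x) (Ioi 0) := by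
  simpa using integrableOn_eval_mul h.natDegree_eq h.leadingCoeff_pos h.integrable (X ^ k)

theorem isOrthonormalFor (h : IsOrthonormalSeq α ν l t p) :
    IsOrthonormalFor (momentFunctional (weightMoment α ν l t)) p where
  natDegree_eq := h.natDegree_eq
  leadingCoeff_pos := h.leadingCoeff_pos
  apply_mul m n := by
    rw [← h.integral_eq m n]
    simp_rw [← eval_mul]
    exact (integral_eval_mul h.integrableOn_pow_mul _).symm

theorem eq {q : ℕ → ℝ[X]} (hp : IsOrthonormalSeq α ν l t p) (hq : IsOrthonormalSeq α ν l t q)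
    (n : ℕ) : p n = q n :=
  hp.isOrthonormalFor.unique hq.isOrthonormalFor n

/-- Since `λ` and `t` enter only through `λx` and `xt`, replacing `x` by `cx` scales the weight by
`c^α`; the Jacobian adds a factor `c`, and the normalisation is the square root of `c^{α+1}`. -/
theorem rescale (h : IsOrthonormalSeq α ν l t p) {c : ℝ} (hc : 0 < c) :
    IsOrthonormalSeq α ν (c * l) (c * t)
      (fun n => C (c ^ ((α + 1) / 2)) * (p n).comp (C c * X)) := by
  have hcγ : 0 < c ^ ((α + 1) / 2) := Real.rpow_pos_of_pos hc _
  have hcoeff : ∀ n k, (C (c ^ ((α + 1) / 2)) * (p n).comp (C c * X)).coeff k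
      = c ^ ((α + 1) / 2) * ((p n).coeff k * c ^ k) := fun n k => by
    rw [coeff_C_mul, comp_C_mul_X_coeff]
  have hdeg : ∀ n, (C (c ^ ((α + 1) / 2)) * (p n).comp (C c * X)).natDegree = n := by
    intro n
    rw [natDegree_C_mul hcγ.ne', natDegree_comp, natDegree_C_mul_X _ hc.ne', h.natDegree_eq,
      mul_one]
  have hfun : ∀ m n, EqOn
      (fun x : ℝ => (C (c ^ ((α + 1) / 2)) * (p m).comp (C c * X)).eval x
        * (C (c ^ ((α + 1) / 2)) * (p n).comp (C c * X)).eval x * weight α ν (c * l) (c * t) x)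
      (fun x => c * ((fun y => (p m).eval y * (p n).eval y * weight α ν l t y) (c * x)))
      (Ioi 0) := by
    intro m n x hx
    have hpow : c ^ ((α + 1) / 2) * c ^ ((α + 1) / 2) = c * c ^ α := by
      rw [← Real.rpow_add hc, add_halves, add_comm, Real.rpow_add hc, Real.rpow_one]
    have hw : weight α ν l t (c * x) = c ^ α * weight α ν (c * l) (c * t) x := by
      simp only [weight]
      rw [Real.mul_rpow hc.le (le_of_lt hx), show -l * (c * x) = -(c * l) * x by ring,
        show c * x * t = x * (c * t) by ring]
      ring
    simp only [eval_mul, eval_C, eval_comp, eval_X, hw]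
    linear_combination ((p m).eval (c * x) * (p n).eval (c * x) * weight α ν (c * l) (c * t) x)
      * hpow
  refine ⟨hdeg, fun n => ?_, fun m n => ?_, fun m n => ?_⟩
  · rw [leadingCoeff, hdeg, hcoeff]
    have := h.isOrthonormalFor.coeff_pos n
    positivity
  · refine IntegrableOn.congr_fun ?_ (hfun m n).symm measurableSet_Ioi
    refine Integrable.const_mul ?_ _
    have := (integrableOn_Ioi_comp_mul_left_iff
      (fun y => (p m).eval y * (p n).eval y * weight α ν l t y) 0 hc).2
    rw [mul_zero] at this
    exact this (h.integrable m n)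
  · rw [setIntegral_congr_fun measurableSet_Ioi (hfun m n), integral_const_mul,
      integral_comp_mul_left_Ioi
        (fun y => (p m).eval y * (p n).eval y * weight α ν l t y) _ hc, mul_zero, h.integral_eq, smul_eq_mul,
      mul_inv_cancel_left₀ hc.ne']

end IsOrthonormalSeq

theorem hasDerivWithinAt_weightMoment {α ν l t : ℝ} (hlt : Admissible ν l t)
    (hint : ∀ s, Admissible ν s t → ∀ k : ℕ,
      IntegrableOn (fun x : ℝ => x ^ k * weight α ν s t x) (Ioi 0)) (k : ℕ) :
    HasDerivWithinAt (fun s => weightMoment α ν s t k) (-weightMoment α ν l t (k + 1))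
      (Ici 0) l := by
  obtain ⟨hl, ht, hne, hν⟩ := hlt
  have hadm : ∀ s, l / 2 ≤ s → Admissible ν s t := by
    intro s hs
    refine ⟨by linarith, ht, fun h => hne ?_, hν⟩
    have hs0 : s = 0 := by nlinarith
    have ht0 : t = 0 := by nlinarith
    have hl0 : l = 0 := by linarith
    simp [hl0, ht0]
  have hw : ∀ s k, (fun x : ℝ => x ^ k * weight α ν s t x)
      = fun x => Real.exp (-s * x) * (x ^ k * (x ^ α * rho ν (x * t))) := by
    intro s k; ext x; simp only [weight]; ring
  have hw' : ∀ s k, (fun x : ℝ => x ^ (k + 1) * weight α ν s t x)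
      = fun x => x * (Real.exp (-s * x) * (x ^ k * (x ^ α * rho ν (x * t)))) := by
    intro s k; ext x; simp only [weight]; ring
  -- With base point `l / 2`, `Ici (l / 2)` is a neighbourhood of `l` if `l > 0` and equals `Ici 0`
  -- if `l = 0`; the base point stays admissible even for `t = 0`.
  have key := hasDerivWithinAt_integral_exp_mul (v := fun x => x ^ k * (x ^ α * rho ν (x * t)))
    (s₀ := l / 2) (s := l) (by linarith)
    (fun u hu => by rw [← hw]; exact hint u (hadm u hu) k)
    (by rw [← hw']; exact hint _ (hadm _ le_rfl) (k + 1))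
  simp only [weightMoment, hw _ k, hw' _ k]
  refine key.mono_of_mem_nhdsWithin ?_
  rcases hl.eq_or_lt with rfl | hl
  · simpa using self_mem_nhdsWithin
  · exact mem_nhdsWithin_of_mem_nhds (Ici_mem_nhds (by linarith))

theorem Admissible.eventually_left {ν l t : ℝ} (h : Admissible ν l t) :
    ∀ᶠ s in 𝓝[Ici 0] l, Admissible ν s t := by
  obtain ⟨hl, ht, hne, hν⟩ := h
  rcases ht.eq_or_lt with rfl | ht'
  · have hl' : 0 < l := lt_of_le_of_ne hl (by rintro rfl; simp at hne)
    filter_upwards [mem_nhdsWithin_of_mem_nhds (Ioi_mem_nhds hl')] with s hs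
    have hs : 0 < s := hs
    exact ⟨hs.le, le_rfl, by positivity, hν⟩
  · filter_upwards [self_mem_nhdsWithin] with s hs
    exact ⟨hs, ht, by positivity, hν⟩

theorem Admissible.of_pos {ν l t : ℝ} (hl : 0 ≤ l) (ht : 0 < t) : Admissible ν l t :=
  ⟨hl, ht.le, by positivity, fun h => absurd h ht.ne'⟩

theorem hasDerivAt_rpow_mul_pow_one (γ : ℝ) (k : ℕ) :
    HasDerivAt (fun c : ℝ => c ^ γ * c ^ k) (γ + k) 1 := by
  exact ((Real.hasDerivAt_rpow_const (x := 1) (p := γ) (Or.inl one_ne_zero)).mul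
    (hasDerivAt_pow k (1 : ℝ))).congr_deriv (by simp)

/-! ### Derivatives of the coefficients in `λ` and `t` -/

section Family

variable {α ν : ℝ} {P : ℕ → ℝ → ℝ → ℝ[X]}
  (hP : ∀ l t : ℝ, Admissible ν l t → IsOrthonormalSeq α ν l t (fun n => P n l t))
include hP

theorem coeff_rescale {l t c : ℝ} (h : Admissible ν l t) (h' : Admissible ν (c * l) (c * t))
    (hc : 0 < c) (n k : ℕ) :
    (P n (c * l) (c * t)).coeff k = c ^ ((α + 1) / 2) * c ^ k * (P n l t).coeff k := by
  rw [(hP _ _ h').eq ((hP _ _ h).rescale hc) n, coeff_C_mul, comp_C_mul_X_coeff]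
  ring

theorem differentiableWithinAt_coeff_left {l t : ℝ} (h : Admissible ν l t) (n k : ℕ) :
    DifferentiableWithinAt ℝ (fun s => (P n s t).coeff k) (Ici 0) l := by
  refine differentiableWithinAt_coeff (m := fun s => weightMoment α ν s t)
    (p := fun s n => P n s t) ?_ h.1 (fun k => ?_) n k
  · filter_upwards [h.eventually_left] with s hs using (hP s t hs).isOrthonormalFor
  · exact (hasDerivWithinAt_weightMoment h
      (fun s hs => (hP s t hs).integrableOn_pow_mul) k).differentiableWithinAt

theorem sum_derivWithin_coeff_left {l t : ℝ} (h : Admissible ν l t) {n : ℕ} (hn : 1 ≤ n) (x : ℝ) :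
    ∑ k ∈ Finset.range (n + 1), derivWithin (fun s => (P n s t).coeff k) (Ici 0) l * x ^ k
      = derivWithin (fun s => (P n s t).coeff n) (Ici 0) l / (P n l t).coeff n * (P n l t).eval x
        + (P (n - 1) l t).coeff (n - 1) / (P n l t).coeff n * (P (n - 1) l t).eval x := by
  have := sum_derivWithin_coeff_mul_X_pow (m := fun s => weightMoment α ν s t)
    (p := fun s n => P n s t) (S := Ici 0) (s := l)
    (by filter_upwards [h.eventually_left] with s hs using (hP s t hs).isOrthonormalFor) h.1
    (uniqueDiffOn_Ici 0 l h.1) (fun k => hasDerivWithinAt_weightMoment h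
      (fun s hs => (hP s t hs).integrableOn_pow_mul) k) n hn
  simpa [eval_finsetSum] using congrArg (fun q => q.eval x) this

/-- Write `(l, s) = (s/t) · (lt/s, t)`: dilation turns variation in `t` into variation in `λ` at
fixed `t`, where differentiability is known. -/
theorem hasDerivAt_coeff_right {l t : ℝ} (h : Admissible ν l t) (ht : 0 < t) (n k : ℕ) :
    HasDerivAt (fun s => (P n l s).coeff k)
      ((((α + 1) / 2 + k) * (P n l t).coeff k
        - l * derivWithin (fun s => (P n s t).coeff k) (Ici 0) l) / t) t := by
  have h1 : HasDerivAt (fun s : ℝ => l * t / s) (-(l / t)) t := by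
    simp only [div_eq_mul_inv]
    exact ((hasDerivAt_inv ht.ne').const_mul (l * t)).congr_deriv (by field_simp)
  have h2 : HasDerivAt (fun s => (P n (l * t / s) t).coeff k)
      (derivWithin (fun s => (P n s t).coeff k) (Ici 0) l * -(l / t)) t :=
    HasDerivWithinAt.comp_hasDerivAt_of_eq t
      (differentiableWithinAt_coeff_left hP h n k).hasDerivWithinAt h1
      (by filter_upwards [Ioi_mem_nhds ht] with s hs
          exact div_nonneg (mul_nonneg h.1 ht.le) (le_of_lt hs))
      (by field_simp)
  have h3 : HasDerivAt (fun s : ℝ => (s / t) ^ ((α + 1) / 2) * (s / t) ^ k)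
      (((α + 1) / 2 + k) * (1 / t)) t :=
    HasDerivAt.comp_of_eq t (hasDerivAt_rpow_mul_pow_one _ k) ((hasDerivAt_id t).div_const t)
      (div_self ht.ne').symm
  have h4 := h3.mul h2
  have h5 : l * t / t = l := by field_simp
  simp only [div_self ht.ne', h5, Real.one_rpow, one_pow] at h4
  refine HasDerivAt.congr_of_eventuallyEq (f₁ := fun s => (P n l s).coeff k)
    (h4.congr_deriv (by ring)) ?_
  filter_upwards [Ioi_mem_nhds ht] with s hs
  have hs : 0 < s := hs
  have e1 : s / t * (l * t / s) = l := by field_simp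
  have e2 : s / t * t = s := by field_simp
  have := coeff_rescale hP (l := l * t / s) (t := t) (c := s / t)
    (.of_pos (div_nonneg (mul_nonneg h.1 ht.le) hs.le) ht)
    (by rw [e1, e2]; exact .of_pos h.1 hs) (by positivity) n k
  rwa [e1, e2] at this

/-- On the axis `t = 0` dilation moves `λ` alone, so the coefficient is a constant times a power of
`λ`. -/
theorem mul_derivWithin_coeff_left_of_eq_zero {l : ℝ} (h : Admissible ν l 0) (n k : ℕ) :
    l * derivWithin (fun s => (P n s 0).coeff k) (Ici 0) l
      = ((α + 1) / 2 + k) * (P n l 0).coeff k := by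
  have hl : 0 < l := lt_of_le_of_ne h.1 (by rintro rfl; simp [Admissible] at h)
  have h3 : HasDerivAt (fun s : ℝ => (s / l) ^ ((α + 1) / 2) * (s / l) ^ k)
      (((α + 1) / 2 + k) * (1 / l)) l :=
    HasDerivAt.comp_of_eq l (hasDerivAt_rpow_mul_pow_one _ k) ((hasDerivAt_id l).div_const l)
      (div_self hl.ne').symm
  have h4 : HasDerivAt (fun s => (P n s 0).coeff k)
      (((α + 1) / 2 + k) * (1 / l) * (P n l 0).coeff k) l := by
    refine (h3.mul_const ((P n l 0).coeff k)).congr_of_eventuallyEq ?_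
    filter_upwards [Ioi_mem_nhds hl] with s hs
    have hs : 0 < s := hs
    have e1 : s / l * l = s := by field_simp
    have := coeff_rescale hP (c := s / l) h
      (by rw [e1, mul_zero]; exact ⟨hs.le, le_rfl, by positivity, h.2.2.2⟩) (by positivity) n k
    rwa [e1, mul_zero] at this
  rw [derivWithin_of_mem_nhds (Ici_mem_nhds hl), h4.deriv]
  field_simp

/-- Euler's relation for homogeneous functions, coefficient by coefficient. At `t = 0` the value of
`derivWithin` is irrelevant because of the factor `t`. -/
theorem mul_derivWithin_coeff_right {l t : ℝ} (h : Admissible ν l t) (n k : ℕ) :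
    t * derivWithin (fun s => (P n l s).coeff k) (Ici 0) t
      = ((α + 1) / 2 + k) * (P n l t).coeff k
        - l * derivWithin (fun s => (P n s t).coeff k) (Ici 0) l := by
  rcases h.2.1.eq_or_lt with rfl | ht
  · rw [mul_derivWithin_coeff_left_of_eq_zero hP h]; ring
  · rw [derivWithin_of_mem_nhds (Ici_mem_nhds ht), (hasDerivAt_coeff_right hP h ht n k).deriv]
    field_simp

end Family

/-! ### From coefficients to values, and the two equations -/

theorem hasDerivWithinAt_eval {q : ℝ → ℝ[X]} {S : Set ℝ} {s : ℝ} {n : ℕ} (hs : s ∈ S)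
    (hq : ∀ᶠ u in 𝓝[S] s, (q u).natDegree = n)
    (hd : ∀ k, DifferentiableWithinAt ℝ (fun u => (q u).coeff k) S s) (x : ℝ) :
    HasDerivWithinAt (fun u => (q u).eval x)
      (∑ k ∈ Finset.range (n + 1), derivWithin (fun u => (q u).coeff k) S s * x ^ k) S s := by
  refine HasDerivWithinAt.congr_of_eventuallyEq_of_mem
    (f := fun u => ∑ k ∈ Finset.range (n + 1), (q u).coeff k * x ^ k)
    (HasDerivWithinAt.fun_sum fun k _ => (hd k).hasDerivWithinAt.mul_const _) ?_ hs
  filter_upwards [hq] with u hu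
  rw [eval_eq_sum_range, hu]

theorem Polynomial.mul_eval_derivative (q : ℝ[X]) (x : ℝ) :
    x * (derivative q).eval x = ∑ k ∈ Finset.range (q.natDegree + 1), k * q.coeff k * x ^ k := by
  rw [derivative_eval, sum_over_range _ (by simp), Finset.mul_sum]
  refine Finset.sum_congr rfl fun k _ => ?_
  cases k with
  | zero => simp
  | succ k => rw [Nat.add_sub_cancel]; ring

theorem theorem2 (α ν : ℝ) (hα : -1 < α) (hν : 0 ≤ ν)
    -- `P n l t` is the polynomial `P_n(·; λ, t)`, and `a n l t` is its leading coefficient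
    (P : ℕ → ℝ → ℝ → ℝ[X])
    (hP : ∀ l t : ℝ, Admissible ν l t → IsOrthonormalSeq α ν l t (fun n => P n l t))
    (a : ℕ → ℝ → ℝ → ℝ) (ha : ∀ n l t, a n l t = (P n l t).leadingCoeff)
    (A : ℕ → ℝ → ℝ → ℝ) (hA : ∀ n l t, A n l t = a (n - 1) l t / a n l t)
    (n : ℕ) (hn : 1 ≤ n) (l t : ℝ) (hlt : Admissible ν l t) :
    -- the derivatives exist (one-sided in `λ` at `λ = 0`)
    (DifferentiableWithinAt ℝ (fun s => a n s t) (Ici 0) l ∧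
      (∀ x : ℝ, DifferentiableWithinAt ℝ (fun s => (P n s t).eval x) (Ici 0) l)) ∧
    (0 < t → DifferentiableAt ℝ (fun s => a n l s) t ∧
      (∀ x : ℝ, DifferentiableAt ℝ (fun s => (P n l s).eval x) t)) ∧
    -- the equation in `λ`
    (∀ x : ℝ,
      derivWithin (fun s => (P n s t).eval x) (Ici 0) l
        - 1 / a n l t * derivWithin (fun s => a n s t) (Ici 0) l * (P n l t).eval x
        - A n l t * (P (n - 1) l t).eval x = 0) ∧
    -- the equation in `t`; for `t = 0` the terms with the factor `t` vanish
    (∀ x : ℝ,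
      (t * derivWithin (fun s => (P n l s).eval x) (Ici 0) t - x * (derivative (P n l t)).eval x)
        - (t / a n l t * derivWithin (fun s => a n l s) (Ici 0) t - n) * (P n l t).eval x
        + l * A n l t * (P (n - 1) l t).eval x = 0) := by
  have hcoeff : ∀ m u v, Admissible ν u v → a m u v = (P m u v).coeff m := fun m u v h => by
    rw [ha, leadingCoeff, (hP u v h).natDegree_eq]
  have ha0 : (P n l t).coeff n ≠ 0 := ((hP l t hlt).isOrthonormalFor.coeff_pos n).ne'
  have hal : (fun s => a n s t) =ᶠ[𝓝[Ici 0] l] fun s => (P n s t).coeff n := by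
    filter_upwards [hlt.eventually_left] with s hs using hcoeff n s t hs
  have hdl := fun k => differentiableWithinAt_coeff_left hP hlt n k
  have hel := fun x => hasDerivWithinAt_eval (q := fun s => P n s t) (S := Ici 0) hlt.1
    (by filter_upwards [hlt.eventually_left] with s hs using (hP s t hs).natDegree_eq n) hdl x
  have hdal := hal.derivWithin_eq (hal.self_of_nhdsWithin hlt.1)
  have hadm : 0 < t → ∀ᶠ s in 𝓝 t, Admissible ν l s := fun ht => by
    filter_upwards [Ioi_mem_nhds ht] with s hs using .of_pos hlt.1 hs
  have har : 0 < t → (fun s => a n l s) =ᶠ[𝓝 t] fun s => (P n l s).coeff n := fun ht => by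
    filter_upwards [hadm ht] with s hs using hcoeff n l s hs
  have her : 0 < t → ∀ x, HasDerivWithinAt (fun s => (P n l s).eval x)
      (∑ k ∈ Finset.range (n + 1), derivWithin (fun s => (P n l s).coeff k) (Ici 0) t * x ^ k)
      (Ici 0) t := fun ht x => by
    refine hasDerivWithinAt_eval (q := fun s => P n l s) ht.le ?_
      (fun k => (hasDerivAt_coeff_right hP hlt ht n k).differentiableAt.differentiableWithinAt) x
    filter_upwards [mem_nhdsWithin_of_mem_nhds (hadm ht)] with s hs using (hP l s hs).natDegree_eq n
  have hA' : A n l t = (P (n - 1) l t).coeff (n - 1) / (P n l t).coeff n := by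
    rw [hA, hcoeff _ _ _ hlt, hcoeff _ _ _ hlt]
  have hta : t * derivWithin (fun s => a n l s) (Ici 0) t
      = t * derivWithin (fun s => (P n l s).coeff n) (Ici 0) t := by
    rcases hlt.2.1.eq_or_lt with rfl | ht
    · simp
    · rw [((har ht).filter_mono nhdsWithin_le_nhds).derivWithin_eq (har ht).self_of_nhds]
  have hte : ∀ x, t * derivWithin (fun s => (P n l s).eval x) (Ici 0) t
      = ∑ k ∈ Finset.range (n + 1),
        t * derivWithin (fun s => (P n l s).coeff k) (Ici 0) t * x ^ k := fun x => by
    rcases hlt.2.1.eq_or_lt with rfl | ht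
    · simp
    · rw [(her ht x).derivWithin (uniqueDiffOn_Ici 0 t ht.le), Finset.mul_sum]
      exact Finset.sum_congr rfl fun k _ => by ring
  refine ⟨⟨(hdl n).congr_of_eventuallyEq hal (hal.self_of_nhdsWithin hlt.1),
    fun x => (hel x).differentiableWithinAt⟩, fun ht => ⟨?_, fun x => ?_⟩, fun x => ?_, fun x => ?_⟩
  · exact (hasDerivAt_coeff_right hP hlt ht n n).differentiableAt.congr_of_eventuallyEq (har ht)
  · exact ((her ht x).hasDerivAt (Ici_mem_nhds ht)).differentiableAt
  · rw [(hel x).derivWithin (uniqueDiffOn_Ici 0 l hlt.1), sum_derivWithin_coeff_left hP hlt hn,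
      hdal, hA', hcoeff _ _ _ hlt]
    ring
  · have hsum := sum_derivWithin_coeff_left hP hlt hn x
    have hPx : (P n l t).eval x = ∑ k ∈ Finset.range (n + 1), (P n l t).coeff k * x ^ k := by
      rw [eval_eq_sum_range, (hP l t hlt).natDegree_eq n]
    -- Summing Euler's relation over `k`: the contribution of the exponent `k` is cancelled by `x
    -- ∂/∂x`, leaving the constant `(α + 1) / 2`.
    have hEuler : t * derivWithin (fun s => (P n l s).eval x) (Ici 0) t
          - x * (derivative (P n l t)).eval x
        = (α + 1) / 2 * (P n l t).eval x - l * ∑ k ∈ Finset.range (n + 1),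
          derivWithin (fun s => (P n s t).coeff k) (Ici 0) l * x ^ k := by
      rw [hte, Polynomial.mul_eval_derivative, (hP l t hlt).natDegree_eq n, hPx, Finset.mul_sum,
        Finset.mul_sum, ← Finset.sum_sub_distrib, ← Finset.sum_sub_distrib]
      refine Finset.sum_congr rfl fun k _ => ?_
      rw [mul_derivWithin_coeff_right hP hlt]
      ring
    -- Euler's relation for the leading coefficient, `k = n`, removes both `(α + 1) / 2` and the
    -- `λ`-derivative of `a_n`.
    rw [hEuler, hsum, hA', hcoeff _ _ _ hlt,
      div_mul_eq_mul_div t, hta, mul_derivWithin_coeff_right hP hlt]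
    field_simp
    ring
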